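/- All groups are countable. A free p.m.p. action of a group $\Gamma$ is an essentially free action of $\Gamma$ by measure preserving Borel automorphisms on a standard Borel probability space $(X,\mu)$; its orbit equivalence relation is denoted $\mathcal R_{\alpha(\Gamma)}$, and equivalence relations are considered up to $\mu$-null sets. Given groups $\Gamma_1,\Gamma_2$ with subgroups $\Gamma_1^0<\Gamma_1$ and $\Gamma_2^0<\Gamma_2$, an orbit equivalence of the pairs $(\Gamma_1^0<\Gamma_1)$ and $(\Gamma_2^0<\Gamma_2)$ consists of free p.m.p. actions $\alpha_1$ of $\Gamma_1$ and $\alpha_2$ of $\Gamma_2$ on the same standard Borel probability space $(X,\mu)$ such that $\mathcal R_{\alpha_1(\Gamma_1)}=\mathcal R_{\alpha_2(\Gamma_2)}$ and $\mathcal R_{\alpha_1(\Gamma_1^0)}=\mathcal R_{\alpha_2(\Gamma_2^0)}$. It is strong, via the group isomorphism $\phi:\Gamma_1^0\to\Gamma_2^0$, if moreover for every $\gamma\in\Gamma_1^0$ one has $\alpha_1(\gamma)x=\alpha_2(\phi(\gamma))x$ for $\mu$-almost every $x$. We write $(\Gamma_1^0<\Gamma_1)\overset{OE}{\sim}(\Gamma_2^0<\Gamma_2)$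 if an orbit equivalence of the pairs exists, and $(\Gamma_1^0<\Gamma_1)\underset{st}{\overset{OE}{\sim}}(\Gamma_2^0<\Gamma_2)$ if a strong one (via some isomorphism) exists. Theorem. Let $G$ and $\Gamma_1$ be countable groups, $\Gamma^0<G$ and $\Gamma_1^0<\Gamma_1$ subgroups, and $e_1:\Gamma^0\to\Gamma_1^0$ an isomorphism. (1) Let $\Gamma_2$ be a countable group, $\Gamma_2^0<\Gamma_2$ a subgroup and $e_2:\Gamma^0\to\Gamma_2^0$ an isomorphism. If the pairs $(\Gamma_1^0<\Gamma_1)$ and $(\Gamma_2^0<\Gamma_2)$ admit a strong orbit equivalence of pairs via the isomorphism $e_2\circ e_1^{-1}:\Gamma_1^0\to\Gamma_2^0$, then $$(G<G*_{\Gamma^0=\Gamma_1^0}\Gamma_1)\underset{st}{\overset{OE}{\sim}}(G<G*_{\Gamma^0=\Gamma_2^0}\Gamma_2),$$ where the amalgamated free products are formed along $e_1$ and $e_2$ respectively. (2) In particular, let $\Gamma_2'$ be a countable group. If $(\Gamma_1^0<\Gamma_1)\overset{OE}{\sim}(\Gamma_1^0<\Gamma_1^0*\Gamma_2')$ (an orbit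 equivalence of pairs, not necessarily strong), then $$(G<G*_{\Gamma^0=\Gamma_1^0}\Gamma_1)\underset{st}{\overset{OE}{\sim}}(G<G*\Gamma_2').$$ -/

import Mathlib

open MeasureTheory

universe u

/-! ## Amalgamated free products of two groups -/

/-- The family of groups `G`, `K`, indexed by the two booleans. -/
def AmalgFactor (G K : Type u) : Bool → Type u
  | false => G
  | true => K

instance AmalgFactor.instGroup (G K : Type u) [Group G] [Group K] :
    (b : Bool) → Group (AmalgFactor G K b)
  | false => inferInstanceAs (Group G)
  | true => inferInstanceAs (Group K)

/-- The family of the two homomorphisms `f : H → G` and `k : H → K`. -/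
def amalgMap {H G K : Type u} [Group H] [Group G] [Group K] (f : H →* G) (k : H →* K) :
    (b : Bool) → H →* AmalgFactor G K b
  | false => f
  | true => k

/-- The amalgamated free product `G *_H K` along `f : H → G` and `k : H → K` (used below only for
injective `f` and `k`), as a pushout of groups. -/
abbrev AmalgProd {H G K : Type u} [Group H] [Group G] [Group K] (f : H →* G) (k : H →* K) :
    Type u :=
  Monoid.PushoutI (amalgMap f k)

/-- The canonical homomorphism `G → G *_H K`. -/
def AmalgProd.inl {H G K : Type u} [Group H] [Group G] [Group K] (f : H →* G) (k : H →* K) :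
    G →* AmalgProd f k :=
  Monoid.PushoutI.of (φ := amalgMap f k) false

/-! ## Orbit equivalence of pairs of groups -/

/-- `α` is an essentially free action of `Γ` on `X` by measurable transformations that preserve the
measure `μ`. -/
structure IsFreePMP {Γ X : Type*} [Group Γ] [MeasurableSpace X] (μ : Measure X)
    (α : Γ →* Equiv.Perm X) : Prop where
  measurePreserving : ∀ g : Γ, MeasurePreserving (α g) μ μ
  essentiallyFree : ∀ᵐ x ∂μ, ∀ g : Γ, α g x = x → g = 1

/-- The subgroups `H₁` and `H₂`, acting through `α₁` and `α₂`, have the same orbit equivalence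
relation up to a null set: the two orbits of almost every point coincide. -/
def SameOrbits {Γ₁ Γ₂ X : Type*} [Group Γ₁] [Group Γ₂] [MeasurableSpace X] (μ : Measure X)
    (α₁ : Γ₁ →* Equiv.Perm X) (H₁ : Subgroup Γ₁) (α₂ : Γ₂ →* Equiv.Perm X) (H₂ : Subgroup Γ₂) :
    Prop :=
  ∀ᵐ x ∂μ, ∀ y : X, (∃ g ∈ H₁, α₁ g x = y) ↔ (∃ g ∈ H₂, α₂ g x = y)

/-- `α₁` and `α₂` form an orbit equivalence of the pairs `H₁ < Γ₁` and `H₂ < Γ₂` on `(X, μ)`. -/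
structure IsPairOE {Γ₁ Γ₂ X : Type*} [Group Γ₁] [Group Γ₂] [MeasurableSpace X] (μ : Measure X)
    (H₁ : Subgroup Γ₁) (H₂ : Subgroup Γ₂)
    (α₁ : Γ₁ →* Equiv.Perm X) (α₂ : Γ₂ →* Equiv.Perm X) : Prop where
  left : IsFreePMP μ α₁
  right : IsFreePMP μ α₂
  sameOrbits : SameOrbits μ α₁ ⊤ α₂ ⊤
  sameSubOrbits : SameOrbits μ α₁ H₁ α₂ H₂

/-- The pairs `H₁ < Γ₁` and `H₂ < Γ₂` admit an orbit equivalence of pairs, on some standard Borel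
probability space. (Every standard Borel space is isomorphic to one whose points form a type in the
lowest universe, so taking `X : Type` loses nothing.) -/
def PairOE {Γ₁ Γ₂ : Type*} [Group Γ₁] [Group Γ₂] (H₁ : Subgroup Γ₁) (H₂ : Subgroup Γ₂) : Prop :=
  ∃ (X : Type) (_ : MeasurableSpace X) (_ : StandardBorelSpace X)
    (μ : Measure X) (_ : IsProbabilityMeasure μ)
    (α₁ : Γ₁ →* Equiv.Perm X) (α₂ : Γ₂ →* Equiv.Perm X),
    IsPairOE μ H₁ H₂ α₁ α₂

/-- The pairs `H₁ < Γ₁` and `H₂ < Γ₂` admit a strong orbit equivalence of pairs whose isomorphism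
of the subgroups is `φ`: the actions of `γ` and of `φ γ` agree almost everywhere. -/
def StrongPairOEVia {Γ₁ Γ₂ : Type*} [Group Γ₁] [Group Γ₂] (H₁ : Subgroup Γ₁) (H₂ : Subgroup Γ₂)
    (φ : H₁ ≃* H₂) : Prop :=
  ∃ (X : Type) (_ : MeasurableSpace X) (_ : StandardBorelSpace X)
    (μ : Measure X) (_ : IsProbabilityMeasure μ)
    (α₁ : Γ₁ →* Equiv.Perm X) (α₂ : Γ₂ →* Equiv.Perm X),
    IsPairOE μ H₁ H₂ α₁ α₂ ∧
      ∀ γ : H₁, ∀ᵐ x ∂μ, α₁ (γ : Γ₁) x = α₂ (φ γ : Γ₂) x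

/-- The pairs `H₁ < Γ₁` and `H₂ < Γ₂` admit a strong orbit equivalence of pairs. -/
def StrongPairOE {Γ₁ Γ₂ : Type*} [Group Γ₁] [Group Γ₂] (H₁ : Subgroup Γ₁) (H₂ : Subgroup Γ₂) :
    Prop :=
  ∃ φ : H₁ ≃* H₂, StrongPairOEVia H₁ H₂ φ

/-!
After discarding a null set, freeness and equality of orbits hold at every point, and the actions
`α₁`, `α₂` of `Γ₁`, `Γ₂` agree literally on the amalgamated subgroup. Coinducing `α₁` to
`G *_H Γ₁`, and multiplying by a Bernoulli action to make the result free, gives an action `β₁`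
whose restriction to `Γ₁` factors onto `α₁`. Along the factor map, `α₂` lifts by its orbit cocycle
to an action of `Γ₂` with the same orbits as `Γ₁`, which can then be glued to the given action of
`G`. The glued action of `G *_H Γ₂` has the same orbits as `β₁`, because both orbit relations are
generated by those of the two factors. It is free, because at each point a reduced word of
`G *_H Γ₂` acts like some reduced word of `G *_H Γ₁` with the same pattern of factors, and such a
word is nontrivial.

A not necessarily strong orbit equivalence with `K * L`, where `K` is the distinguished subgroup,
becomes strong when the action of the factor `K` is replaced by the action it has as a subgroup of
`Γ₁`: the orbits of both factors are unchanged, so the new action is free for the same reason.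
Finally, `G *_H (K * L)` is `G * L` when `H → K` is an isomorphism.
-/

section Orbits

variable {Γ Λ X : Type*} [Group Γ] [Group Λ]

theorem orbitRel_iSup [MulAction Γ X] {ι : Sort*} (S : ι → Subgroup Γ) :
    MulAction.orbitRel (⨆ i, S i : Subgroup Γ) X = ⨆ i, MulAction.orbitRel (S i) X := by
  apply le_antisymm
  · rintro _ x ⟨⟨g, hg⟩, rfl⟩
    refine Subgroup.iSup_induction S
      (C := fun g => ∀ x : X, (⨆ i, MulAction.orbitRel (S i) X) (g • x) x) hg
      (fun i g hg x => ?_) (fun x => ?_) (fun g h hg hh x => ?_) x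
    · exact le_iSup (fun i => MulAction.orbitRel (S i) X) i ⟨⟨g, hg⟩, rfl⟩
    · exact (one_smul Γ x).symm ▸ Setoid.refl' _ x
    · exact mul_smul g h x ▸ Setoid.trans' _ (hg (h • x)) (hh x)
  · refine iSup_le fun i => ?_
    rintro _ x ⟨⟨g, hg⟩, rfl⟩
    exact ⟨⟨g, Subgroup.mem_iSup_of_mem i hg⟩, rfl⟩

/-- The orbit equivalence relation of an action `α`, written `R_{α(Γ)}` in the literature. The
relation of a subgroup `H` is `orbitSetoid (α.comp H.subtype)`. -/
def orbitSetoid (α : Γ →* Equiv.Perm X) : Setoid X :=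
  MulAction.orbitRel α.range X

theorem orbitSetoid_apply {α : Γ →* Equiv.Perm X} {x y : X} :
    orbitSetoid α x y ↔ ∃ g, α g x = y :=
  (orbitSetoid α).comm'.trans
    ⟨fun ⟨⟨_, g, rfl⟩, h⟩ => ⟨g, h⟩, fun ⟨g, h⟩ => ⟨⟨α g, g, rfl⟩, h⟩⟩

theorem orbitSetoid_rel_apply (α : Γ →* Equiv.Perm X) (g : Γ) (x : X) :
    orbitSetoid α x (α g x) :=
  orbitSetoid_apply.2 ⟨g, rfl⟩

theorem orbitSetoid_comp_of_surjective (α : Γ →* Equiv.Perm X) {f : Λ →* Γ}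
    (hf : Function.Surjective f) : orbitSetoid (α.comp f) = orbitSetoid α := by
  ext x y
  simp only [orbitSetoid_apply, MonoidHom.comp_apply, hf.exists]

theorem orbitSetoid_comp_top_subtype (α : Γ →* Equiv.Perm X) :
    orbitSetoid (α.comp (⊤ : Subgroup Γ).subtype) = orbitSetoid α :=
  orbitSetoid_comp_of_surjective α fun g => ⟨⟨g, trivial⟩, rfl⟩

theorem orbitSetoid_comp_subtype_apply {α : Γ →* Equiv.Perm X} {H : Subgroup Γ} {x y : X} :
    orbitSetoid (α.comp H.subtype) x y ↔ ∃ g ∈ H, α g x = y := by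
  simp [orbitSetoid_apply]

end Orbits

section FreeActions

variable {Γ Λ X : Type*} [Group Γ] [Group Λ]

/-- The action `α` is free at every point, as opposed to almost every point. -/
def ActsFreely (α : Γ →* Equiv.Perm X) : Prop :=
  ∀ x g, α g x = x → g = 1

theorem ActsFreely.eq_of_apply_eq {α : Γ →* Equiv.Perm X} (hα : ActsFreely α) {g h : Γ} {x : X}
    (hx : α g x = α h x) : g = h := by
  refine (inv_mul_eq_one.1 (hα x (h⁻¹ * g) ?_)).symm
  rw [map_mul, Equiv.Perm.mul_apply, hx, ← Equiv.Perm.mul_apply, ← map_mul, inv_mul_cancel,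
    map_one, Equiv.Perm.one_apply]

theorem ActsFreely.comp {α : Γ →* Equiv.Perm X} (hα : ActsFreely α) {j : Λ →* Γ}
    (hj : Function.Injective j) : ActsFreely (α.comp j) :=
  fun x g hg => (map_eq_one_iff j hj).1 (hα x (j g) hg)

end FreeActions

section PushoutI

open Monoid

variable {ι H Y : Type*} {G₁ G₂ : ι → Type*} [∀ i, Group (G₁ i)] [∀ i, Group (G₂ i)] [Group H]
  {φ₁ : ∀ i, H →* G₁ i} {φ₂ : ∀ i, H →* G₂ i}

theorem iSup_range_pushoutI_of [Nonempty ι] :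
    ⨆ i, (PushoutI.of i : G₁ i →* PushoutI φ₁).range = ⊤ := by
  have mem (i : ι) (g : G₁ i) : PushoutI.of i g ∈ ⨆ i, (PushoutI.of (φ := φ₁) i).range :=
    Subgroup.mem_iSup_of_mem i ⟨g, rfl⟩
  refine (Subgroup.eq_top_iff' _).2 fun x => ?_
  induction x using PushoutI.induction_on with
  | of i g => exact mem i g
  | base h =>
    obtain ⟨i⟩ := ‹Nonempty ι›
    exact PushoutI.of_apply_eq_base φ₁ i h ▸ mem i (φ₁ i h)
  | mul x y hx hy => exact mul_mem hx hy

theorem orbitSetoid_pushoutI [Nonempty ι] (β : PushoutI φ₁ →* Equiv.Perm Y) :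
    orbitSetoid β = ⨆ i, orbitSetoid (β.comp (PushoutI.of i)) := by
  have hrange : β.range = ⨆ i, (β.comp (PushoutI.of i)).range := by
    simp only [MonoidHom.range_comp]
    rw [← Subgroup.map_iSup, iSup_range_pushoutI_of, MonoidHom.range_eq_map]
  simp only [orbitSetoid]
  rw [hrange, orbitRel_iSup]

instance countable_pushoutI [Countable ι] [∀ i, Countable (G₁ i)] [Countable H] :
    Countable (PushoutI φ₁) :=
  have : Countable (CoprodI G₁) :=
    (Con.mk'_surjective (c := conGen (CoprodI.Rel G₁))).countable
  have : Countable (Coprod (CoprodI G₁) H) := Coprod.mk_surjective.countable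
  (Con.mk'_surjective (c := PushoutI.con φ₁)).countable

theorem exists_eq_base_mul_reduced_word (hφ : ∀ i, Function.Injective (φ₁ i)) (x : PushoutI φ₁) :
    ∃ (h : H) (w : CoprodI.Word G₁), PushoutI.Reduced φ₁ w ∧
      x = PushoutI.base φ₁ h * PushoutI.ofCoprodI w.prod := by
  classical
  obtain ⟨d⟩ := PushoutI.NormalWord.transversal_nonempty φ₁ hφ
  obtain ⟨w, rfl⟩ := (PushoutI.NormalWord.equiv (d := d)).symm.surjective x
  refine ⟨w.head, w.toWord, fun ⟨i, g⟩ hg hgH => w.ne_one _ hg ?_, rfl⟩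
  have hfix := (d.compl i).equiv_snd_eq_self_of_mem_of_one_mem (one_mem _) (w.normalized i g hg)
  have hone := ((d.compl i).coe_equiv_snd_eq_one_iff_mem (d.one_mem i)).2 hgH
  rwa [hfix] at hone

variable {β₁ : PushoutI φ₁ →* Equiv.Perm Y} {β₂ : PushoutI φ₂ →* Equiv.Perm Y}

theorem exists_notMem_range_apply_eq {i : ι}
    (hfree : ActsFreely (β₂.comp (PushoutI.of i)))
    (hbase : β₁.comp (PushoutI.base φ₁) = β₂.comp (PushoutI.base φ₂))
    (horb : orbitSetoid (β₂.comp (PushoutI.of i)) ≤ orbitSetoid (β₁.comp (PushoutI.of i)))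
    {g : G₂ i} (hg : g ∉ (φ₂ i).range) (y : Y) :
    ∃ g' ∉ (φ₁ i).range, β₁ (PushoutI.of i g') y = β₂ (PushoutI.of i g) y := by
  obtain ⟨g', hg'⟩ := orbitSetoid_apply.1 (horb (orbitSetoid_rel_apply _ g y))
  simp only [MonoidHom.comp_apply] at hg'
  refine ⟨g', ?_, hg'⟩
  rintro ⟨h, rfl⟩
  refine hg ⟨h, hfree.eq_of_apply_eq (x := y) ?_⟩
  simp only [MonoidHom.comp_apply]
  rw [← hg', PushoutI.of_apply_eq_base, PushoutI.of_apply_eq_base]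
  exact (DFunLike.congr_fun (DFunLike.congr_fun hbase h) y).symm

theorem exists_reduced_word_apply_eq
    (hfree : ∀ i, ActsFreely (β₂.comp (PushoutI.of i)))
    (hbase : β₁.comp (PushoutI.base φ₁) = β₂.comp (PushoutI.base φ₂))
    (horb : ∀ i, orbitSetoid (β₂.comp (PushoutI.of i)) ≤ orbitSetoid (β₁.comp (PushoutI.of i)))
    {w : CoprodI.Word G₂} (hw : PushoutI.Reduced φ₂ w) (y : Y) :
    ∃ w' : CoprodI.Word G₁, PushoutI.Reduced φ₁ w' ∧ w'.fstIdx = w.fstIdx ∧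
      β₁ (PushoutI.ofCoprodI w'.prod) y = β₂ (PushoutI.ofCoprodI w.prod) y := by
  induction w using CoprodI.Word.consRecOn with
  | empty => exact ⟨.empty, by simp [PushoutI.Reduced, CoprodI.Word.empty], rfl, by simp⟩
  | cons i g w hwi hg1 ih =>
    obtain ⟨hg, hw⟩ := List.forall_mem_cons.1 hw
    obtain ⟨w', hw', hidx, hact⟩ := ih hw
    obtain ⟨g', hg', hgact⟩ := exists_notMem_range_apply_eq (hfree i) hbase (horb i) hg
      (β₂ (PushoutI.ofCoprodI w.prod) y)
    refine ⟨.cons g' w' (hidx ▸ hwi) fun h => hg' (h ▸ one_mem _),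
      List.forall_mem_cons.2 ⟨hg', hw'⟩, by simp, ?_⟩
    simp only [CoprodI.Word.prod_cons, map_mul, PushoutI.ofCoprodI_of, Equiv.Perm.mul_apply]
    rw [hact, hgact]

theorem ActsFreely.pushoutI_of_orbitSetoid_le (hφ₁ : ∀ i, Function.Injective (φ₁ i))
    (hφ₂ : ∀ i, Function.Injective (φ₂ i)) (hβ₁ : ActsFreely β₁)
    (hfree : ∀ i, ActsFreely (β₂.comp (PushoutI.of i)))
    (hbase : β₁.comp (PushoutI.base φ₁) = β₂.comp (PushoutI.base φ₂))
    (horb : ∀ i, orbitSetoid (β₂.comp (PushoutI.of i)) ≤ orbitSetoid (β₁.comp (PushoutI.of i))) :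
    ActsFreely β₂ := by
  intro y x hx
  obtain ⟨h, w, hw, rfl⟩ := exists_eq_base_mul_reduced_word hφ₂ x
  obtain ⟨w', hw', hidx, hact⟩ := exists_reduced_word_apply_eq hfree hbase horb hw y
  have hx' : PushoutI.base φ₁ h * PushoutI.ofCoprodI w'.prod = 1 := by
    refine hβ₁ y _ ?_
    rw [map_mul, Equiv.Perm.mul_apply] at hx ⊢
    rw [hact]
    exact (DFunLike.congr_fun (DFunLike.congr_fun hbase h) _).trans hx
  obtain rfl : w' = .empty := hw'.eq_empty_of_mem_range hφ₁
    ⟨h⁻¹, by rw [map_inv]; exact inv_eq_of_mul_eq_one_right hx'⟩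
  obtain rfl : w = .empty := CoprodI.Word.ext (by simpa [CoprodI.Word.fstIdx] using hidx.symm)
  obtain rfl : h = 1 := PushoutI.base_injective hφ₁ (by simpa using hx')
  simp

end PushoutI

section StrictActions

variable {Γ Λ Γ₁ Γ₂ X : Type*} [Group Γ] [Group Λ] [Group Γ₁] [Group Γ₂] [MeasurableSpace X]
  {μ : Measure X}

/-- A measure preserving action that is free at every point. Compared with `IsFreePMP`, no null
set has to be discarded. -/
structure IsStrictlyFreePMP (μ : Measure X) (α : Γ →* Equiv.Perm X) : Prop where
  measurePreserving : ∀ g : Γ, MeasurePreserving (α g) μ μ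
  actsFreely : ActsFreely α

theorem IsStrictlyFreePMP.isFreePMP {α : Γ →* Equiv.Perm X} (hα : IsStrictlyFreePMP μ α) :
    IsFreePMP μ α :=
  ⟨hα.measurePreserving, .of_forall hα.actsFreely⟩

theorem IsStrictlyFreePMP.comp {α : Γ →* Equiv.Perm X} (hα : IsStrictlyFreePMP μ α)
    {j : Λ →* Γ} (hj : Function.Injective j) : IsStrictlyFreePMP μ (α.comp j) :=
  ⟨fun g => hα.measurePreserving (j g), hα.actsFreely.comp hj⟩

/-- An orbit equivalence without exceptional null sets: both actions are free at every point and
their orbits coincide at every point. -/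
structure IsStrictOE (μ : Measure X) (α₁ : Γ₁ →* Equiv.Perm X) (α₂ : Γ₂ →* Equiv.Perm X) :
    Prop where
  left : IsStrictlyFreePMP μ α₁
  right : IsStrictlyFreePMP μ α₂
  orbitSetoid_eq : orbitSetoid α₁ = orbitSetoid α₂

theorem sameOrbits_of_orbitSetoid_eq {α₁ : Γ₁ →* Equiv.Perm X} {α₂ : Γ₂ →* Equiv.Perm X}
    {H₁ : Subgroup Γ₁} {H₂ : Subgroup Γ₂}
    (h : orbitSetoid (α₁.comp H₁.subtype) = orbitSetoid (α₂.comp H₂.subtype)) :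
    SameOrbits μ α₁ H₁ α₂ H₂ :=
  .of_forall fun x y => by
    rw [← orbitSetoid_comp_subtype_apply, ← orbitSetoid_comp_subtype_apply, h]

theorem IsStrictOE.isPairOE {α₁ : Γ₁ →* Equiv.Perm X} {α₂ : Γ₂ →* Equiv.Perm X}
    {H₁ : Subgroup Γ₁} {H₂ : Subgroup Γ₂} (hα : IsStrictOE μ α₁ α₂)
    (h : orbitSetoid (α₁.comp H₁.subtype) = orbitSetoid (α₂.comp H₂.subtype)) :
    IsPairOE μ H₁ H₂ α₁ α₂ where
  left := hα.left.isFreePMP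
  right := hα.right.isFreePMP
  sameOrbits := sameOrbits_of_orbitSetoid_eq <| by
    simp only [orbitSetoid_comp_top_subtype, hα.orbitSetoid_eq]
  sameSubOrbits := sameOrbits_of_orbitSetoid_eq h

theorem IsStrictOE.comp_mulEquiv {α₁ : Γ₁ →* Equiv.Perm X} {α₂ : Γ₂ →* Equiv.Perm X}
    (hα : IsStrictOE μ α₁ α₂) (e : Λ ≃* Γ₂) : IsStrictOE μ α₁ (α₂.comp e.toMonoidHom) where
  left := hα.left
  right := hα.right.comp e.injective
  orbitSetoid_eq := by rw [hα.orbitSetoid_eq, orbitSetoid_comp_of_surjective α₂ e.surjective]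

end StrictActions

section PushoutI

open Monoid

variable {ι H Y : Type*} [Nonempty ι] {G₁ G₂ : ι → Type*} [∀ i, Group (G₁ i)] [∀ i, Group (G₂ i)]
  [Group H] {φ₁ : ∀ i, H →* G₁ i} {φ₂ : ∀ i, H →* G₂ i} [MeasurableSpace Y] {ν : Measure Y}
  {β₁ : PushoutI φ₁ →* Equiv.Perm Y} {β₂ : PushoutI φ₂ →* Equiv.Perm Y}

theorem measurePreserving_pushoutI (h : ∀ i g, MeasurePreserving (β₁ (PushoutI.of i g)) ν ν)
    (x : PushoutI φ₁) : MeasurePreserving (β₁ x) ν ν := by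
  induction x using PushoutI.induction_on with
  | of i g => exact h i g
  | base g =>
    obtain ⟨i⟩ := ‹Nonempty ι›
    exact PushoutI.of_apply_eq_base φ₁ i g ▸ h i (φ₁ i g)
  | mul x y hx hy =>
    rw [map_mul, Equiv.Perm.coe_mul]
    exact hx.comp hy

theorem isStrictOE_pushoutI (hφ₁ : ∀ i, Function.Injective (φ₁ i))
    (hφ₂ : ∀ i, Function.Injective (φ₂ i)) (hβ₁ : IsStrictlyFreePMP ν β₁)
    (hβ₂ : ∀ i, IsStrictlyFreePMP ν (β₂.comp (PushoutI.of i)))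
    (hbase : β₁.comp (PushoutI.base φ₁) = β₂.comp (PushoutI.base φ₂))
    (horb : ∀ i, orbitSetoid (β₁.comp (PushoutI.of i)) = orbitSetoid (β₂.comp (PushoutI.of i))) :
    IsStrictOE ν β₁ β₂ where
  left := hβ₁
  right :=
    { measurePreserving := measurePreserving_pushoutI fun i g => (hβ₂ i).measurePreserving g
      actsFreely := hβ₁.actsFreely.pushoutI_of_orbitSetoid_le hφ₁ hφ₂
        (fun i => (hβ₂ i).actsFreely) hbase fun i => (horb i).ge }
  orbitSetoid_eq := by simp only [orbitSetoid_pushoutI, horb]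

end PushoutI

section ConullSets

variable {Γ Γ₁ Γ₂ X Y : Type*} [Group Γ] [Group Γ₁] [Group Γ₂]

/-- The restriction of an action to an invariant set. -/
def restrictAction (α : Γ →* Equiv.Perm X) (S : Set X) (hS : ∀ g, Set.MapsTo (α g) S S) :
    Γ →* Equiv.Perm S where
  toFun g := (α g).subtypePerm fun x => ⟨fun h => by simpa using hS g⁻¹ h, fun h => hS g h⟩
  map_one' := by ext; simp
  map_mul' g h := Equiv.ext fun x => Subtype.ext (DFunLike.congr_fun (map_mul α g h) (x : X))

@[simp]
theorem coe_restrictAction (α : Γ →* Equiv.Perm X) {S : Set X} (hS : ∀ g, Set.MapsTo (α g) S S)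
    (g : Γ) (x : S) : (restrictAction α S hS g x : X) = α g x :=
  rfl

theorem orbitSetoid_restrictAction_comp_subtype_apply {α : Γ →* Equiv.Perm X} {S : Set X}
    (hS : ∀ g, Set.MapsTo (α g) S S) (H : Subgroup Γ) {x y : S} :
    orbitSetoid ((restrictAction α S hS).comp H.subtype) x y ↔ ∃ g ∈ H, α g x = y := by
  simp [orbitSetoid_comp_subtype_apply, Subtype.ext_iff]

variable [MeasurableSpace X] [MeasurableSpace Y] {μ : Measure X}

theorem measurePreserving_of_semiconj {ν : Measure Y} {q : Y → X} {σ : Y → Y} {τ : X → X}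
    (hq : MeasurePreserving q ν μ) (hqe : MeasurableEmbedding q) (hτ : MeasurePreserving τ μ μ)
    (h : Function.Semiconj q σ τ) : MeasurePreserving σ ν ν := by
  have hσ : Measurable σ :=
    hqe.measurable_comp_iff.1 (h.comp_eq ▸ hτ.measurable.comp hq.measurable)
  have hmap : (ν.map σ).map q = ν.map q := by
    rw [Measure.map_map hq.measurable hσ, h.comp_eq, (hτ.comp hq).map_eq, hq.map_eq]
  exact ⟨hσ, by rw [← hqe.comap_map (ν.map σ), hmap, hqe.comap_map]⟩

theorem measurePreserving_coe_of_conull {S : Set X} (hSm : MeasurableSet S)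
    (hS : ∀ᵐ x ∂μ, x ∈ S) : MeasurePreserving ((↑) : S → X) (μ.comap (↑)) μ := by
  simpa only [Measure.restrict_eq_self_of_ae_mem hS] using
    measurePreserving_subtype_coe hSm (μa := μ)

theorem isProbabilityMeasure_comap_coe [IsProbabilityMeasure μ] {S : Set X}
    (hSm : MeasurableSet S) (hS : ∀ᵐ x ∂μ, x ∈ S) :
    IsProbabilityMeasure (μ.comap ((↑) : S → X)) :=
  (MeasurableEmbedding.subtype_coe hSm).isProbabilityMeasure_comap (by simpa using hS)

theorem isStrictlyFreePMP_restrictAction {α : Γ →* Equiv.Perm X} {S : Set X}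
    (hα : ∀ g, MeasurePreserving (α g) μ μ) (hinv : ∀ g, Set.MapsTo (α g) S S)
    (hSm : MeasurableSet S) (hS : ∀ᵐ x ∂μ, x ∈ S) (hfree : ∀ x ∈ S, ∀ g, α g x = x → g = 1) :
    IsStrictlyFreePMP (μ.comap ((↑) : S → X)) (restrictAction α S hinv) where
  measurePreserving g := measurePreserving_of_semiconj (measurePreserving_coe_of_conull hSm hS)
    (.subtype_coe hSm) (hα g) fun _ => rfl
  actsFreely x g hg := hfree x x.2 g (congrArg Subtype.val hg)

theorem exists_invariant_conull [Countable Γ] {α : Γ →* Equiv.Perm X}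
    (hα : ∀ g, MeasurePreserving (α g) μ μ) {P : X → Prop} (hP : ∀ᵐ x ∂μ, P x) :
    ∃ S : Set X, MeasurableSet S ∧ (∀ᵐ x ∂μ, x ∈ S) ∧ (∀ g, Set.MapsTo (α g) S S) ∧
      ∀ x ∈ S, P x := by
  obtain ⟨T, hT, hTm, hTP⟩ := hP.exists_measurable_mem
  refine ⟨⋂ g, α g ⁻¹' T, .iInter fun g => (hα g).measurable hTm, ?_, fun g x hx => ?_,
    fun x hx => hTP x (by simpa using Set.mem_iInter.1 hx 1)⟩
  · simp only [Set.mem_iInter]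
    exact ae_all_iff.2 fun g => (hα g).quasiMeasurePreserving.ae hT
  · exact Set.mem_iInter.2 fun k => by simpa using Set.mem_iInter.1 hx (k * g)

theorem IsPairOE.exists_isStrictOE_restrictAction [Countable Γ₁] {H₁ : Subgroup Γ₁}
    {H₂ : Subgroup Γ₂} {α₁ : Γ₁ →* Equiv.Perm X} {α₂ : Γ₂ →* Equiv.Perm X}
    (h : IsPairOE μ H₁ H₂ α₁ α₂) {P : X → Prop} (hP : ∀ᵐ x ∂μ, P x) :
    ∃ (S : Set X) (h₁ : ∀ g, Set.MapsTo (α₁ g) S S) (h₂ : ∀ g, Set.MapsTo (α₂ g) S S),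
      MeasurableSet S ∧ (∀ᵐ x ∂μ, x ∈ S) ∧ (∀ x ∈ S, P x) ∧
      IsStrictOE (μ.comap ((↑) : S → X)) (restrictAction α₁ S h₁) (restrictAction α₂ S h₂) := by
  obtain ⟨S, hSm, hS, h₁, hSP⟩ := exists_invariant_conull h.left.measurePreserving
    (h.left.essentiallyFree.and (h.right.essentiallyFree.and (h.sameOrbits.and hP)))
  have h₂ (g : Γ₂) : Set.MapsTo (α₂ g) S S := by
    intro x hx
    obtain ⟨k, -, hk⟩ := ((hSP x hx).2.2.1 (α₂ g x)).2 ⟨g, trivial, rfl⟩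
    exact hk ▸ h₁ k hx
  refine ⟨S, h₁, h₂, hSm, hS, fun x hx => (hSP x hx).2.2.2,
    isStrictlyFreePMP_restrictAction h.left.measurePreserving h₁ hSm hS fun x hx => (hSP x hx).1,
    isStrictlyFreePMP_restrictAction h.right.measurePreserving h₂ hSm hS
      fun x hx => (hSP x hx).2.1, ?_⟩
  ext x y
  simpa [orbitSetoid_apply, Subtype.ext_iff] using (hSP x x.2).2.2.1 y

variable {H₁ : Subgroup Γ₁} {H₂ : Subgroup Γ₂}

theorem PairOE.exists_isStrictOE [Countable Γ₁] (h : PairOE H₁ H₂) :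
    ∃ (X : Type) (_ : MeasurableSpace X) (_ : StandardBorelSpace X)
      (μ : Measure X) (_ : IsProbabilityMeasure μ)
      (α₁ : Γ₁ →* Equiv.Perm X) (α₂ : Γ₂ →* Equiv.Perm X), IsStrictOE μ α₁ α₂ ∧
      orbitSetoid (α₁.comp H₁.subtype) = orbitSetoid (α₂.comp H₂.subtype) := by
  obtain ⟨X, _, _, μ, _, α₁, α₂, hα⟩ := h
  obtain ⟨S, h₁, h₂, hSm, hS, hsub, hstrict⟩ :=
    hα.exists_isStrictOE_restrictAction hα.sameSubOrbits
  refine ⟨S, inferInstance, hSm.standardBorel, μ.comap (↑),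
    isProbabilityMeasure_comap_coe hSm hS, _, _, hstrict, ?_⟩
  ext x y
  rw [orbitSetoid_restrictAction_comp_subtype_apply, orbitSetoid_restrictAction_comp_subtype_apply]
  exact hsub x x.2 y

end ConullSets

section StrictOEOver

variable {G L Γ₁ Γ₂ Γ₃ : Type*} [Group G] [Group L] [Group Γ₁] [Group Γ₂] [Group Γ₃]
  {j₁ : G →* Γ₁} {j₂ : G →* Γ₂}

/-- A strict orbit equivalence of `Γ₁` and `Γ₂`, on some standard Borel probability space, in which
`G` acts in the same way through `j₁` and `j₂`. This is a strong orbit equivalence of pairs phrased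
with homomorphisms instead of subgroups, and without null sets. -/
def StrictOEOver (j₁ : G →* Γ₁) (j₂ : G →* Γ₂) : Prop :=
  ∃ (X : Type) (_ : MeasurableSpace X) (_ : StandardBorelSpace X)
    (μ : Measure X) (_ : IsProbabilityMeasure μ)
    (α₁ : Γ₁ →* Equiv.Perm X) (α₂ : Γ₂ →* Equiv.Perm X),
    IsStrictOE μ α₁ α₂ ∧ α₁.comp j₁ = α₂.comp j₂

theorem StrongPairOEVia.strictOEOver [Countable Γ₁] {H₁ : Subgroup Γ₁} {H₂ : Subgroup Γ₂}
    {φ : H₁ ≃* H₂} (h : StrongPairOEVia H₁ H₂ φ) :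
    StrictOEOver H₁.subtype (H₂.subtype.comp φ.toMonoidHom) := by
  obtain ⟨X, _, _, μ, _, α₁, α₂, hα, hφ⟩ := h
  obtain ⟨S, h₁, h₂, hSm, hS, hagree, hstrict⟩ :=
    hα.exists_isStrictOE_restrictAction (ae_all_iff.2 hφ)
  refine ⟨S, inferInstance, hSm.standardBorel, μ.comap (↑),
    isProbabilityMeasure_comap_coe hSm hS, _, _, hstrict, ?_⟩
  exact MonoidHom.ext fun γ => Equiv.ext fun x => Subtype.ext (hagree x x.2 γ)

theorem StrictOEOver.strongPairOE_range (h : StrictOEOver j₁ j₂) (hj₁ : Function.Injective j₁)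
    (hj₂ : Function.Injective j₂) : StrongPairOE j₁.range j₂.range := by
  obtain ⟨X, _, _, μ, _, α₁, α₂, hα, hj⟩ := h
  have hagree (g : G) (x : X) : α₁ (j₁ g) x = α₂ (j₂ g) x :=
    DFunLike.congr_fun (DFunLike.congr_fun hj g) x
  let r₁ := MonoidHom.ofInjective hj₁
  let r₂ := MonoidHom.ofInjective hj₂
  refine ⟨r₁.symm.trans r₂, X, inferInstance, inferInstance, μ, inferInstance, α₁, α₂,
    hα.isPairOE ?_, fun γ => .of_forall fun x => ?_⟩
  · ext x y
    simp [orbitSetoid_comp_subtype_apply, hagree]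
  · obtain ⟨g, rfl⟩ := r₁.surjective γ
    rw [MulEquiv.trans_apply, MulEquiv.symm_apply_apply]
    exact hagree g x

theorem StrictOEOver.comp (h : StrictOEOver j₁ j₂) (i : L →* G) :
    StrictOEOver (j₁.comp i) (j₂.comp i) := by
  obtain ⟨X, _, _, μ, _, α₁, α₂, hα, hj⟩ := h
  exact ⟨X, inferInstance, inferInstance, μ, inferInstance, α₁, α₂, hα,
    congrArg (MonoidHom.comp · i) hj⟩

theorem StrictOEOver.of_mulEquiv_apply {j₃ : G →* Γ₃} (h : StrictOEOver j₁ j₂) {e : Γ₂ ≃* Γ₃}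
    (he : ∀ g, e (j₂ g) = j₃ g) : StrictOEOver j₁ j₃ := by
  obtain ⟨X, _, _, μ, _, α₁, α₂, hα, hj⟩ := h
  refine ⟨X, inferInstance, inferInstance, μ, inferInstance, α₁, _, hα.comp_mulEquiv e.symm, ?_⟩
  rw [hj]
  ext g
  simp [← he]

end StrictOEOver

section MeasurePreserving

variable {Γ X Y : Type*} [Group Γ] [MeasurableSpace X] [MeasurableSpace Y]

theorem measurePreserving_of_forall_eq_apply {ι : Type*} [Countable ι] {ν : Measure Y}
    {σ : Equiv.Perm Y} {τ : ι → Y → Y} {c : Y → ι} (hτ : ∀ i, MeasurePreserving (τ i) ν ν)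
    (hτe : ∀ i, MeasurableEmbedding (τ i)) (hc : ∀ i, MeasurableSet (c ⁻¹' {i}))
    (hσ : ∀ y, σ y = τ (c y) y) : MeasurePreserving σ ν ν := by
  set A : ι → Set Y := fun i => c ⁻¹' {i}
  have hdisj : Pairwise (Function.onFun Disjoint A) := fun _ _ h =>
    (Set.disjoint_singleton.2 h).preimage c
  have hcover : ⋃ i, A i = Set.univ := by ext; simp [A]
  have hστ (i : ι) : Set.EqOn σ (τ i) (A i) := fun y hy => by rw [hσ, show c y = i from hy]
  have himage (i : ι) : MeasurableSet (σ '' A i) :=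
    (hστ i).image_eq ▸ (hτe i).measurableSet_image' (hc i)
  have hσm : Measurable σ := by
    intro B hB
    have : σ ⁻¹' B = ⋃ i, A i ∩ τ i ⁻¹' B := by ext; simp [A, hσ]
    exact this ▸ .iUnion fun i => (hc i).inter ((hτ i).measurable hB)
  refine ⟨hσm, ?_⟩
  calc ν.map σ
      = (Measure.sum fun i => ν.restrict (A i)).map σ := by
        rw [← Measure.restrict_iUnion hdisj hc, hcover, Measure.restrict_univ]
    _ = Measure.sum fun i => (ν.restrict (A i)).map σ := Measure.map_sum hσm.aemeasurable
    _ = Measure.sum fun i => ν.restrict (σ '' A i) := by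
        congr! 2 with i
        rw [Measure.map_congr (ae_restrict_of_forall_mem (hc i) (hστ i)), (hστ i).image_eq]
        exact ((hτ i).restrict_image_emb (hτe i) (A i)).map_eq
    _ = ν := by
        have hdisj' : Pairwise (Function.onFun Disjoint fun i => σ '' A i) := fun _ _ h =>
          (Set.disjoint_image_iff σ.injective).2 (hdisj h)
        rw [← Measure.restrict_iUnion hdisj' himage, ← Set.image_iUnion, hcover, Set.image_univ,
          σ.surjective.range_eq, Measure.restrict_univ]

theorem measurableEmbedding_of_measurable {β : Γ →* Equiv.Perm Y} (hβ : ∀ g, Measurable (β g))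
    (g : Γ) : MeasurableEmbedding (β g) :=
  MeasurableEquiv.measurableEmbedding
    ⟨β g, hβ g, by simpa only [map_inv, Equiv.Perm.inv_def] using hβ g⁻¹⟩

theorem measurePreserving_infinitePi_of_injective {ι κ : Type*} {μ : Measure X}
    [IsProbabilityMeasure μ] {e : ι → κ} (he : Function.Injective e) {a : ι → X → X}
    (ha : ∀ i, MeasurePreserving (a i) μ μ) :
    MeasurePreserving (fun (f : κ → X) i => a i (f (e i)))
      (Measure.infinitePi fun _ => μ) (Measure.infinitePi fun _ => μ) := by
  have hcomp : MeasurePreserving (fun (f : κ → X) i => f (e i))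
      (Measure.infinitePi fun _ => μ) (Measure.infinitePi fun _ => μ) :=
    ⟨by fun_prop, Measure.map_infinitePi_infinitePi_of_inj he⟩
  refine MeasurePreserving.comp (g := fun (f : ι → X) i => a i (f i)) ⟨?_, ?_⟩ hcomp
  · exact measurable_pi_iff.2 fun i => (ha i).measurable.comp (measurable_pi_apply i)
  · simp only [Measure.infinitePi_map_pi _ fun i => (ha i).measurable, (ha _).map_eq]

end MeasurePreserving

section Coinduction

variable {Λ X : Type*} [Group Λ] {H : Subgroup Λ}

/-- The cocycle `Λ × Λ ⧸ H → H` of the translation action of `Λ` on the cosets of `H`, relative to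
the section `Quotient.out`. It is evaluated at the target `t` of the translation `g⁻¹ • t ↦ t`. -/
noncomputable def cosetCocycle (H : Subgroup Λ) (g : Λ) (t : Λ ⧸ H) : H :=
  ⟨t.out⁻¹ * g * (g⁻¹ • t).out, by
    have h : ((g⁻¹ * t.out : Λ) : Λ ⧸ H) = ((g⁻¹ • t).out : Λ ⧸ H) := by
      rw [QuotientGroup.out_eq', ← smul_eq_mul, MulAction.Quotient.coe_smul_out]
    simpa [mul_assoc] using QuotientGroup.eq.1 h⟩

theorem cosetCocycle_one (t : Λ ⧸ H) : cosetCocycle H 1 t = 1 := by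
  ext; simp [cosetCocycle]

theorem cosetCocycle_mul (g g' : Λ) (t : Λ ⧸ H) :
    cosetCocycle H (g * g') t = cosetCocycle H g t * cosetCocycle H g' (g⁻¹ • t) := by
  ext; simp [cosetCocycle, mul_assoc, mul_smul]

/-- The co-induction to `Λ` of an action of a subgroup `H` on `X`, realized on the functions
`Λ ⧸ H → X` by means of `cosetCocycle`. -/
noncomputable def coinducedAction (α : H →* Equiv.Perm X) : Λ →* Equiv.Perm (Λ ⧸ H → X) :=
  MonoidHom.toHomPerm
    { toFun g f t := α (cosetCocycle H g t) (f (g⁻¹ • t))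
      map_one' := by funext f t; simp [cosetCocycle_one, Function.End.one_def]
      map_mul' g g' := by
        funext f t
        simp only [cosetCocycle_mul, mul_inv_rev, mul_smul, map_mul, Equiv.Perm.mul_apply]
        rfl }

theorem coinducedAction_apply (α : H →* Equiv.Perm X) (g : Λ) (f : Λ ⧸ H → X) (t : Λ ⧸ H) :
    coinducedAction α g f t = α (cosetCocycle H g t) (f (g⁻¹ • t)) :=
  rfl

/-- The representative in `H` that `Quotient.out` selects for the trivial coset. -/
noncomputable def trivialCosetRep (H : Subgroup Λ) : H :=
  ⟨((1 : Λ) : Λ ⧸ H).out, by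
    simpa using QuotientGroup.eq.1 (QuotientGroup.out_eq' ((1 : Λ) : Λ ⧸ H)).symm⟩

theorem coe_inv_smul_trivialCoset (h : H) : (h⁻¹ : Λ) • ((1 : Λ) : Λ ⧸ H) = (1 : Λ) := by
  change (((h⁻¹ : Λ) * 1 : Λ) : Λ ⧸ H) = (1 : Λ)
  simp [QuotientGroup.eq]

theorem cosetCocycle_trivialCoset (h : H) :
    cosetCocycle H h ((1 : Λ) : Λ ⧸ H) = (trivialCosetRep H)⁻¹ * h * trivialCosetRep H := by
  ext
  simp only [cosetCocycle, coe_inv_smul_trivialCoset]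
  rfl

/-- The factor map from the co-induced action, restricted to `H`, onto the original action. The
twist by `trivialCosetRep` is needed because `Quotient.out` need not select `1`. -/
noncomputable def coinducedFactor (α : H →* Equiv.Perm X) (f : Λ ⧸ H → X) : X :=
  α (trivialCosetRep H) (f ((1 : Λ) : Λ ⧸ H))

theorem coinducedFactor_coinducedAction (α : H →* Equiv.Perm X) (h : H) (f : Λ ⧸ H → X) :
    coinducedFactor α (coinducedAction α h f) = α h (coinducedFactor α f) := by
  simp only [coinducedFactor, coinducedAction_apply, coe_inv_smul_trivialCoset,
    cosetCocycle_trivialCoset, ← Equiv.Perm.mul_apply, ← map_mul]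
  congr 2
  group

variable [MeasurableSpace X] {μ : Measure X} [IsProbabilityMeasure μ] {α : H →* Equiv.Perm X}

theorem measurePreserving_coinducedAction (hα : ∀ h, MeasurePreserving (α h) μ μ) (g : Λ) :
    MeasurePreserving (coinducedAction α g)
      (Measure.infinitePi fun _ => μ) (Measure.infinitePi fun _ => μ) :=
  measurePreserving_infinitePi_of_injective (MulAction.injective g⁻¹) fun _ => hα _

theorem measurePreserving_coinducedFactor (hα : ∀ h, MeasurePreserving (α h) μ μ) :
    MeasurePreserving (coinducedFactor α) (Measure.infinitePi fun _ => μ) μ :=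
  (hα _).comp (measurePreserving_eval_infinitePi (fun _ : Λ ⧸ H => μ) _)

end Coinduction

section FreeExtensions

variable {Λ X Y : Type*} [Group Λ]

/-- The Bernoulli shift of `Λ` on `Λ → X`. -/
def bernoulliAction (Λ X : Type*) [Group Λ] : Λ →* Equiv.Perm (Λ → X) :=
  letI := arrowAction (G := Λ) (A := Λ) (B := X)
  MulAction.toPermHom Λ (Λ → X)

theorem bernoulliAction_apply (g : Λ) (f : Λ → X) (t : Λ) :
    bernoulliAction Λ X g f t = f (g⁻¹ * t) :=
  rfl

/-- The diagonal action on a product. -/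
def prodAction (α : Λ →* Equiv.Perm X) (β : Λ →* Equiv.Perm Y) : Λ →* Equiv.Perm (X × Y) where
  toFun g := (α g).prodCongr (β g)
  map_one' := by ext <;> simp
  map_mul' g h := by ext <;> simp

variable [MeasurableSpace X] [MeasurableSpace Y]

theorem ae_prod_fst_ne_snd [MeasurableEq X] (μ ν : Measure X) [SFinite ν] [NullSingletonClass ν] :
    ∀ᵐ z ∂μ.prod ν, z.1 ≠ z.2 := by
  have hmeas : MeasurableSet {z : X × X | z.1 ≠ z.2} :=
    (measurableSet_eq_fun measurable_fst measurable_snd).compl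
  refine (Measure.ae_prod_iff_ae_ae hmeas).2 (.of_forall fun x => ?_)
  filter_upwards [Measure.ae_ne ν x] with y hy using hy.symm

theorem isFreePMP_bernoulliAction [MeasurableEq X] [Countable Λ] (μ : Measure X)
    [IsProbabilityMeasure μ] [NullSingletonClass μ] :
    IsFreePMP (Measure.infinitePi fun _ : Λ => μ) (bernoulliAction Λ X) where
  measurePreserving g :=
    measurePreserving_infinitePi_of_injective (mul_right_injective g⁻¹) fun _ => .id μ
  essentiallyFree := ae_all_iff.2 fun g => by
    rcases eq_or_ne g 1 with rfl | hg
    · simp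
    have hne := ae_prod_fst_ne_snd μ μ
    rw [← Measure.infinitePi_map_eval_prod (P := fun _ : Λ => μ) hg] at hne
    filter_upwards [ae_of_ae_map (by fun_prop) hne] with f hf hfix
    have := congrFun hfix g
    rw [bernoulliAction_apply, inv_mul_cancel] at this
    exact absurd this.symm hf

theorem isFreePMP_prodAction {α : Λ →* Equiv.Perm X} {β : Λ →* Equiv.Perm Y} {μ : Measure X}
    {ν : Measure Y} [SFinite μ] [SFinite ν] (hα : ∀ g, MeasurePreserving (α g) μ μ)
    (hβ : IsFreePMP ν β) : IsFreePMP (μ.prod ν) (prodAction α β) where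
  measurePreserving g := (hα g).prod (hβ.measurePreserving g)
  essentiallyFree := by
    filter_upwards [Measure.quasiMeasurePreserving_snd.ae hβ.essentiallyFree] with z hz g hg
    exact hz g (congrArg Prod.snd hg)

theorem exists_free_extension {Λ X : Type} [Group Λ] [Countable Λ] [MeasurableSpace X]
    [StandardBorelSpace X] {μ : Measure X} [IsProbabilityMeasure μ] {H : Subgroup Λ}
    {α : H →* Equiv.Perm X} (hα : ∀ h, MeasurePreserving (α h) μ μ) :
    ∃ (Y : Type) (_ : MeasurableSpace Y) (_ : StandardBorelSpace Y) (ν : Measure Y)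
      (_ : IsProbabilityMeasure ν) (β : Λ →* Equiv.Perm Y) (p : Y → X),
      IsStrictlyFreePMP ν β ∧ MeasurePreserving p ν μ ∧
      ∀ h : H, Function.Semiconj p (β h) (α h) := by
  have : Countable (Λ ⧸ H) := Quotient.mk_surjective.countable
  let ν₀ := (Measure.infinitePi fun _ : Λ ⧸ H => μ).prod
    (Measure.infinitePi fun _ : Λ => (volume : Measure unitInterval))
  let β := prodAction (coinducedAction α) (bernoulliAction Λ unitInterval)
  have hβ : IsFreePMP ν₀ β := isFreePMP_prodAction (measurePreserving_coinducedAction hα)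
    (isFreePMP_bernoulliAction volume)
  obtain ⟨S, hSm, hS, hinv, hfree⟩ :=
    exists_invariant_conull hβ.measurePreserving hβ.essentiallyFree
  refine ⟨S, inferInstance, hSm.standardBorel, ν₀.comap (↑),
    isProbabilityMeasure_comap_coe hSm hS, restrictAction β S hinv,
    fun y => coinducedFactor α y.1.1,
    isStrictlyFreePMP_restrictAction hβ.measurePreserving hinv hSm hS hfree,
    ((measurePreserving_coinducedFactor hα).comp measurePreserving_fst).comp
      (measurePreserving_coe_of_conull hSm hS),
    fun h y => coinducedFactor_coinducedAction α h y.1.1⟩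

theorem exists_free_extension_of_injective {Λ Γ : Type*} {X : Type} [Group Λ] [Group Γ]
    [Countable Λ] {j : Γ →* Λ} (hj : Function.Injective j) [MeasurableSpace X]
    [StandardBorelSpace X] {μ : Measure X} [IsProbabilityMeasure μ] {α : Γ →* Equiv.Perm X}
    (hα : ∀ g, MeasurePreserving (α g) μ μ) :
    ∃ (Y : Type) (_ : MeasurableSpace Y) (_ : StandardBorelSpace Y) (ν : Measure Y)
      (_ : IsProbabilityMeasure ν) (β : Λ →* Equiv.Perm Y) (p : Y → X),
      IsStrictlyFreePMP ν β ∧ MeasurePreserving p ν μ ∧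
      ∀ g : Γ, Function.Semiconj p (β (j g)) (α g) := by
  let e : Λ ≃* Shrink.{0} Λ := Shrink.mulEquiv.symm
  have : Countable (Shrink.{0} Λ) := e.symm.injective.countable
  let r := MonoidHom.ofInjective (f := e.toMonoidHom.comp j) (e.injective.comp hj)
  obtain ⟨Y, _, _, ν, _, β, p, hβ, hp, hpα⟩ :=
    exists_free_extension (α := α.comp r.symm.toMonoidHom) fun h => hα (r.symm h)
  refine ⟨Y, inferInstance, inferInstance, ν, inferInstance, β.comp e.toMonoidHom, p,
    hβ.comp e.injective, hp, fun g => ?_⟩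
  have h := hpα (r g)
  rwa [MonoidHom.comp_apply, MulEquiv.coe_toMonoidHom, r.symm_apply_apply] at h

end FreeExtensions

section OrbitCocycle

variable {Γ₁ Γ₂ X Y : Type*} [Group Γ₁] [Group Γ₂] {α₁ : Γ₁ →* Equiv.Perm X}
  {α₂ : Γ₂ →* Equiv.Perm X}

/-- The Zimmer cocycle of an inclusion of orbits: an element of `Γ₁` that moves `x` to `α₂ g x`. It
is unique, and a cocycle, if `Γ₁` acts freely. -/
noncomputable def orbitCocycle (horb : orbitSetoid α₂ ≤ orbitSetoid α₁) (g : Γ₂) (x : X) : Γ₁ :=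
  (orbitSetoid_apply.1 (horb (orbitSetoid_rel_apply α₂ g x))).choose

theorem orbitCocycle_apply (horb : orbitSetoid α₂ ≤ orbitSetoid α₁) (g : Γ₂) (x : X) :
    α₁ (orbitCocycle horb g x) x = α₂ g x :=
  (orbitSetoid_apply.1 (horb (orbitSetoid_rel_apply α₂ g x))).choose_spec

theorem orbitCocycle_eq_iff (horb : orbitSetoid α₂ ≤ orbitSetoid α₁) (hα₁ : ActsFreely α₁) {k : Γ₁}
    {g : Γ₂} {x : X} : orbitCocycle horb g x = k ↔ α₁ k x = α₂ g x :=
  ⟨fun h => h ▸ orbitCocycle_apply horb g x,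
    fun h => hα₁.eq_of_apply_eq ((orbitCocycle_apply horb g x).trans h.symm)⟩

theorem orbitCocycle_one (horb : orbitSetoid α₂ ≤ orbitSetoid α₁) (hα₁ : ActsFreely α₁) (x : X) :
    orbitCocycle horb 1 x = 1 :=
  (orbitCocycle_eq_iff horb hα₁).2 (by simp)

theorem orbitCocycle_mul (horb : orbitSetoid α₂ ≤ orbitSetoid α₁) (hα₁ : ActsFreely α₁) (g h : Γ₂)
    (x : X) : orbitCocycle horb (g * h) x =
      orbitCocycle horb g (α₂ h x) * orbitCocycle horb h x :=
  (orbitCocycle_eq_iff horb hα₁).2 (by simp [orbitCocycle_apply])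

variable (horb : orbitSetoid α₂ ≤ orbitSetoid α₁) (hα₁ : ActsFreely α₁) {β₁ : Γ₁ →* Equiv.Perm Y}
  {p : Y → X} (hp : ∀ g, Function.Semiconj p (β₁ g) (α₁ g))

/-- The lift of the action `α₂` along a factor map `p` from `β₁` to `α₁`: each point is moved by the
element of `Γ₁` that moves its image in `X` in the way `α₂` prescribes. -/
noncomputable def liftAction : Γ₂ →* Equiv.Perm Y :=
  MonoidHom.toHomPerm
    { toFun g y := β₁ (orbitCocycle horb g (p y)) y
      map_one' := by funext y; simp [orbitCocycle_one horb hα₁, Function.End.one_def]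
      map_mul' g h := by
        funext y
        change _ = β₁ (orbitCocycle horb g (p (β₁ (orbitCocycle horb h (p y)) y)))
          (β₁ (orbitCocycle horb h (p y)) y)
        rw [hp, orbitCocycle_apply, orbitCocycle_mul horb hα₁, map_mul, Equiv.Perm.mul_apply] }

theorem liftAction_apply (g : Γ₂) (y : Y) :
    liftAction horb hα₁ hp g y = β₁ (orbitCocycle horb g (p y)) y :=
  rfl

theorem semiconj_liftAction (g : Γ₂) :
    Function.Semiconj p (liftAction horb hα₁ hp g) (α₂ g) := fun y => by
  rw [liftAction_apply, hp, orbitCocycle_apply]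

theorem actsFreely_liftAction (hα₂ : ActsFreely α₂) : ActsFreely (liftAction horb hα₁ hp) :=
  fun y g hg => hα₂ (p y) g (by rw [← semiconj_liftAction horb hα₁ hp g y, hg])

theorem liftAction_apply_eq {g₁ : Γ₁} {g₂ : Γ₂} {y : Y} (h : α₁ g₁ (p y) = α₂ g₂ (p y)) :
    liftAction horb hα₁ hp g₂ y = β₁ g₁ y := by
  rw [liftAction_apply, (orbitCocycle_eq_iff horb hα₁).2 h]

theorem liftAction_comp_eq {L : Type*} [Group L] {k₁ : L →* Γ₁} {k₂ : L →* Γ₂}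
    (h : α₁.comp k₁ = α₂.comp k₂) : (liftAction horb hα₁ hp).comp k₂ = β₁.comp k₁ :=
  MonoidHom.ext fun l => Equiv.ext fun y =>
    liftAction_apply_eq horb hα₁ hp (DFunLike.congr_fun (DFunLike.congr_fun h l) (p y))

theorem orbitSetoid_liftAction (horb' : orbitSetoid α₁ ≤ orbitSetoid α₂) :
    orbitSetoid (liftAction horb hα₁ hp) = orbitSetoid β₁ := by
  ext y z
  simp only [orbitSetoid_apply]
  constructor
  · rintro ⟨g, rfl⟩
    exact ⟨_, (liftAction_apply horb hα₁ hp g y).symm⟩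
  · rintro ⟨g, rfl⟩
    obtain ⟨g₂, hg₂⟩ := orbitSetoid_apply.1 (horb' (orbitSetoid_rel_apply α₁ g (p y)))
    exact ⟨g₂, liftAction_apply_eq horb hα₁ hp hg₂.symm⟩

variable [Countable Γ₁] [MeasurableSpace X] [MeasurableEq X] [MeasurableSpace Y]

theorem measurePreserving_liftAction {ν : Measure Y} (hα₁m : ∀ g, Measurable (α₁ g))
    (hα₂m : ∀ g, Measurable (α₂ g)) (hβ₁ : ∀ g, MeasurePreserving (β₁ g) ν ν) (hpm : Measurable p)
    (g : Γ₂) : MeasurePreserving (liftAction horb hα₁ hp g) ν ν := by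
  refine measurePreserving_of_forall_eq_apply (c := fun y => orbitCocycle horb g (p y)) hβ₁
    (measurableEmbedding_of_measurable fun k => (hβ₁ k).measurable) (fun k => ?_) fun _ => rfl
  have hfiber : (fun y => orbitCocycle horb g (p y)) ⁻¹' {k} = p ⁻¹' {x | α₁ k x = α₂ g x} := by
    ext y
    exact orbitCocycle_eq_iff horb hα₁
  exact hfiber ▸ hpm (measurableSet_eq_fun (hα₁m k) (hα₂m g))

theorem isStrictOE_liftAction {μ : Measure X} {ν : Measure Y} (hα : IsStrictOE μ α₁ α₂)
    (hβ₁ : IsStrictlyFreePMP ν β₁) (hpm : Measurable p) :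
    IsStrictOE ν β₁ (liftAction hα.orbitSetoid_eq.ge hα.left.actsFreely hp) where
  left := hβ₁
  right :=
    { measurePreserving := measurePreserving_liftAction _ _ hp
        (fun g => (hα.left.measurePreserving g).measurable)
        (fun g => (hα.right.measurePreserving g).measurable) hβ₁.measurePreserving hpm
      actsFreely := actsFreely_liftAction _ _ hp hα.right.actsFreely }
  orbitSetoid_eq := (orbitSetoid_liftAction _ _ hp hα.orbitSetoid_eq.le).symm

end OrbitCocycle

section AmalgProd

open Monoid

variable {H G K L : Type u} [Group H] [Group G] [Group K] [Group L] {f : H →* G} {k : H →* K}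

theorem amalgMap_injective (hf : Function.Injective f) (hk : Function.Injective k) :
    ∀ b, Function.Injective (amalgMap f k b)
  | false => hf
  | true => hk

instance countable_amalgProd [Countable H] [Countable G] [Countable K] :
    Countable (AmalgProd f k) :=
  have : ∀ b, Countable (AmalgFactor G K b)
    | false => inferInstanceAs (Countable G)
    | true => inferInstanceAs (Countable K)
  countable_pushoutI

variable (f k) in
/-- The canonical homomorphism `K → G *_H K`. -/
def AmalgProd.inr : K →* AmalgProd f k :=
  PushoutI.of (φ := amalgMap f k) true

theorem AmalgProd.inl_injective (hf : Function.Injective f) (hk : Function.Injective k) :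
    Function.Injective (AmalgProd.inl f k) :=
  PushoutI.of_injective (amalgMap_injective hf hk) false

theorem AmalgProd.inr_injective (hf : Function.Injective f) (hk : Function.Injective k) :
    Function.Injective (AmalgProd.inr f k) :=
  PushoutI.of_injective (amalgMap_injective hf hk) true

theorem AmalgProd.inl_comp : (AmalgProd.inl f k).comp f = PushoutI.base (amalgMap f k) :=
  PushoutI.of_comp_eq_base (φ := amalgMap f k) false

theorem AmalgProd.inl_comp_eq_inr_comp :
    (AmalgProd.inl f k).comp f = (AmalgProd.inr f k).comp k :=
  AmalgProd.inl_comp.trans (PushoutI.of_comp_eq_base (φ := amalgMap f k) true).symm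

theorem AmalgProd.inl_apply (h : H) : AmalgProd.inl f k (f h) = AmalgProd.inr f k (k h) :=
  DFunLike.congr_fun AmalgProd.inl_comp_eq_inr_comp h

/-- The homomorphism out of `G *_H K` given by homomorphisms out of `G` and `K` that agree
on `H`. -/
def AmalgProd.lift {P : Type*} [Group P] (a : G →* P) (b : K →* P) (h : a.comp f = b.comp k) :
    AmalgProd f k →* P :=
  PushoutI.lift (φ := amalgMap f k) (fun | false => a | true => b) (a.comp f)
    fun | false => rfl | true => h.symm

section Lift

variable {P : Type*} [Group P] (a : G →* P) (b : K →* P) (h : a.comp f = b.comp k)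

@[simp]
theorem AmalgProd.lift_inl (g : G) : AmalgProd.lift a b h (AmalgProd.inl f k g) = a g :=
  PushoutI.lift_of (φ := amalgMap f k) _ _ _ (i := false) g

@[simp]
theorem AmalgProd.lift_inr (g : K) : AmalgProd.lift a b h (AmalgProd.inr f k g) = b g :=
  PushoutI.lift_of (φ := amalgMap f k) _ _ _ (i := true) g

theorem AmalgProd.lift_comp_inl : (AmalgProd.lift a b h).comp (AmalgProd.inl f k) = a :=
  MonoidHom.ext (AmalgProd.lift_inl a b h)

theorem AmalgProd.lift_comp_inr : (AmalgProd.lift a b h).comp (AmalgProd.inr f k) = b :=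
  MonoidHom.ext (AmalgProd.lift_inr a b h)

end Lift

theorem AmalgProd.hom_ext {P : Type*} [Group P] {a b : AmalgProd f k →* P}
    (hl : a.comp (AmalgProd.inl f k) = b.comp (AmalgProd.inl f k))
    (hr : a.comp (AmalgProd.inr f k) = b.comp (AmalgProd.inr f k)) : a = b :=
  PushoutI.hom_ext_nonempty fun | false => hl | true => hr

/-- `G *_H (K * L)` is isomorphic to `G * L` if `H → K` is an isomorphism. -/
def AmalgProd.coprodMulEquiv (f : H →* G) (e : H ≃* K) {k : H →* Coprod K L}
    (hk : ∀ h, k h = Coprod.inl (e h)) : AmalgProd f k ≃* Coprod G L :=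
  let a : AmalgProd f k →* Coprod G L := AmalgProd.lift Coprod.inl
    (Coprod.lift (Coprod.inl.comp (f.comp e.symm.toMonoidHom)) Coprod.inr) (by ext; simp [hk])
  let b : Coprod G L →* AmalgProd f k :=
    Coprod.lift (AmalgProd.inl f k) ((AmalgProd.inr f k).comp Coprod.inr)
  have hinl (x : K) : AmalgProd.inl f k (f (e.symm x)) = AmalgProd.inr f k (Coprod.inl x) := by
    rw [AmalgProd.inl_apply, hk, e.apply_symm_apply]
  have hba : b.comp a = MonoidHom.id _ :=
    AmalgProd.hom_ext (MonoidHom.ext fun g => by simp [a, b]) <| Coprod.hom_ext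
      (MonoidHom.ext fun x => by simp [a, b, hinl]) (MonoidHom.ext fun x => by simp [a, b])
  have hab : a.comp b = MonoidHom.id _ :=
    Coprod.hom_ext (MonoidHom.ext fun g => by simp [a, b]) (MonoidHom.ext fun x => by simp [a, b])
  MonoidHom.toMulEquiv a b hba hab

theorem AmalgProd.coprodMulEquiv_inl (f : H →* G) (e : H ≃* K) {k : H →* Coprod K L}
    (hk : ∀ h, k h = Coprod.inl (e h)) (g : G) :
    AmalgProd.coprodMulEquiv f e hk (AmalgProd.inl f k g) = Coprod.inl g := by
  simp [AmalgProd.coprodMulEquiv]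

/-- Amalgamation over a trivial group is the free product. -/
def AmalgProd.mulEquivCoprod [Subsingleton H] (f : H →* G) (k : H →* K) :
    AmalgProd f k ≃* Coprod G K :=
  MonoidHom.toMulEquiv
    (AmalgProd.lift Coprod.inl Coprod.inr (by ext h; simp [Subsingleton.elim h 1]))
    (Coprod.lift (AmalgProd.inl f k) (AmalgProd.inr f k))
    (AmalgProd.hom_ext (MonoidHom.ext fun g => by simp) (MonoidHom.ext fun x => by simp))
    (Coprod.hom_ext (MonoidHom.ext fun g => by simp) (MonoidHom.ext fun x => by simp))

theorem AmalgProd.mulEquivCoprod_comp_inl [Subsingleton H] (f : H →* G) (k : H →* K) :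
    (AmalgProd.mulEquivCoprod f k).toMonoidHom.comp (AmalgProd.inl f k) = Coprod.inl :=
  MonoidHom.ext fun g => by simp [AmalgProd.mulEquivCoprod]

theorem AmalgProd.mulEquivCoprod_comp_inr [Subsingleton H] (f : H →* G) (k : H →* K) :
    (AmalgProd.mulEquivCoprod f k).toMonoidHom.comp (AmalgProd.inr f k) = Coprod.inr :=
  MonoidHom.ext fun g => by simp [AmalgProd.mulEquivCoprod]

end AmalgProd

section OrbitEquivalence

open Monoid

variable {H G G₁ G₂ K₁ K₂ Γ₁ Γ₂ : Type u} [Group H] [Group G] [Group G₁] [Group G₂] [Group K₁]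
  [Group K₂] [Group Γ₁] [Group Γ₂] {Y : Type*} [MeasurableSpace Y] {ν : Measure Y}

theorem isStrictOE_amalgProd {f₁ : H →* G₁} {f₂ : H →* G₂} {k₁ : H →* K₁} {k₂ : H →* K₂}
    (hf₁ : Function.Injective f₁) (hf₂ : Function.Injective f₂)
    (hk₁ : Function.Injective k₁) (hk₂ : Function.Injective k₂)
    {β₁ : AmalgProd f₁ k₁ →* Equiv.Perm Y} {β₂ : AmalgProd f₂ k₂ →* Equiv.Perm Y}
    (hH : β₁.comp ((AmalgProd.inl f₁ k₁).comp f₁) = β₂.comp ((AmalgProd.inl f₂ k₂).comp f₂))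
    (hβ₁ : IsStrictlyFreePMP ν β₁)
    (hG : IsStrictlyFreePMP ν (β₂.comp (AmalgProd.inl f₂ k₂)))
    (hK : IsStrictlyFreePMP ν (β₂.comp (AmalgProd.inr f₂ k₂)))
    (horbG : orbitSetoid (β₁.comp (AmalgProd.inl f₁ k₁)) =
      orbitSetoid (β₂.comp (AmalgProd.inl f₂ k₂)))
    (horbK : orbitSetoid (β₁.comp (AmalgProd.inr f₁ k₁)) =
      orbitSetoid (β₂.comp (AmalgProd.inr f₂ k₂))) :
    IsStrictOE ν β₁ β₂ :=
  isStrictOE_pushoutI (amalgMap_injective hf₁ hk₁) (amalgMap_injective hf₂ hk₂) hβ₁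
    (fun | false => hG | true => hK) (by rwa [AmalgProd.inl_comp, AmalgProd.inl_comp] at hH)
    (fun | false => horbG | true => horbK)

theorem isStrictOE_coprod {β₁ : Coprod G₁ K₁ →* Equiv.Perm Y} {β₂ : Coprod G₂ K₂ →* Equiv.Perm Y}
    (hβ₁ : IsStrictlyFreePMP ν β₁) (hG : IsStrictlyFreePMP ν (β₂.comp Coprod.inl))
    (hK : IsStrictlyFreePMP ν (β₂.comp Coprod.inr))
    (horbG : orbitSetoid (β₁.comp Coprod.inl) = orbitSetoid (β₂.comp Coprod.inl))
    (horbK : orbitSetoid (β₁.comp Coprod.inr) = orbitSetoid (β₂.comp Coprod.inr)) :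
    IsStrictOE ν β₁ β₂ := by
  have hinj {A : Type u} [Group A] : Function.Injective (1 : PUnit.{u + 1} →* A) :=
    Function.injective_of_subsingleton _
  let e₁ := AmalgProd.mulEquivCoprod (1 : PUnit.{u + 1} →* G₁) (1 : PUnit.{u + 1} →* K₁)
  let e₂ := AmalgProd.mulEquivCoprod (1 : PUnit.{u + 1} →* G₂) (1 : PUnit.{u + 1} →* K₂)
  have h : IsStrictOE ν (β₁.comp e₁.toMonoidHom) (β₂.comp e₂.toMonoidHom) := by
    apply isStrictOE_amalgProd hinj hinj hinj hinj (by simp) (hβ₁.comp e₁.injective)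
    all_goals simpa only [e₁, e₂, MonoidHom.comp_assoc, AmalgProd.mulEquivCoprod_comp_inl,
      AmalgProd.mulEquivCoprod_comp_inr]
  have he₂ : (β₂.comp e₂.toMonoidHom).comp e₂.symm.toMonoidHom = β₂ :=
    MonoidHom.ext fun x => congrArg β₂ (e₂.apply_symm_apply x)
  have h' : IsStrictOE ν (β₁.comp e₁.toMonoidHom) β₂ := he₂ ▸ h.comp_mulEquiv e₂.symm
  exact ⟨hβ₁, h'.right,
    (orbitSetoid_comp_of_surjective β₁ e₁.surjective).symm.trans h'.orbitSetoid_eq⟩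

theorem StrictOEOver.amalgProd [Countable G] [Countable Γ₁] {f : H →* G} {k₁ : H →* Γ₁}
    {k₂ : H →* Γ₂} (hf : Function.Injective f) (hk₁ : Function.Injective k₁)
    (hk₂ : Function.Injective k₂) (h : StrictOEOver k₁ k₂) :
    StrictOEOver (AmalgProd.inl f k₁) (AmalgProd.inl f k₂) := by
  obtain ⟨X, _, _, μ, _, α₁, α₂, hα, hH⟩ := h
  have : Countable H := hf.countable
  obtain ⟨Y, _, _, ν, _, β₁, p, hβ₁, hp, hpα⟩ := exists_free_extension_of_injective
    (AmalgProd.inr_injective hf hk₁) hα.left.measurePreserving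
  have hγ := isStrictOE_liftAction hpα hα (hβ₁.comp (AmalgProd.inr_injective hf hk₁))
    hp.measurable
  have hγH := liftAction_comp_eq (β₁ := β₁.comp (AmalgProd.inr f k₁)) hα.orbitSetoid_eq.ge
    hα.left.actsFreely hpα hH
  set γ := liftAction (β₁ := β₁.comp (AmalgProd.inr f k₁)) hα.orbitSetoid_eq.ge
    hα.left.actsFreely hpα
  have hcompat : (β₁.comp (AmalgProd.inl f k₁)).comp f = γ.comp k₂ := by
    rw [hγH, MonoidHom.comp_assoc, MonoidHom.comp_assoc, AmalgProd.inl_comp_eq_inr_comp]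
  refine ⟨Y, inferInstance, inferInstance, ν, inferInstance, β₁,
    AmalgProd.lift _ γ hcompat, ?_, by rw [AmalgProd.lift_comp_inl]⟩
  apply isStrictOE_amalgProd hf hf hk₁ hk₂ _ hβ₁
  all_goals simp only [AmalgProd.lift_comp_inl, AmalgProd.lift_comp_inr, ← MonoidHom.comp_assoc]
  exacts [hβ₁.comp (AmalgProd.inl_injective hf hk₁), hγ.right, hγ.orbitSetoid_eq]

theorem PairOE.strictOEOver_subtype_inl {Γ L : Type u} [Group Γ] [Countable Γ] [Group L]
    {H : Subgroup Γ} (h : PairOE H (Coprod.inl : H →* Coprod H L).range) :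
    StrictOEOver H.subtype (Coprod.inl : H →* Coprod H L) := by
  obtain ⟨X, _, _, μ, _, α₁, α₂, hα, hsub⟩ := h.exists_isStrictOE
  have hinl : orbitSetoid (α₂.comp Coprod.inl) = orbitSetoid (α₁.comp H.subtype) := by
    rw [hsub]
    ext x y
    simp [orbitSetoid_apply]
  let α₃ : Coprod H L →* Equiv.Perm X :=
    Coprod.lift (α₁.comp H.subtype) (α₂.comp Coprod.inr)
  have h₂₃ : IsStrictOE μ α₂ α₃ := by
    apply isStrictOE_coprod hα.right
    all_goals simp only [α₃, Coprod.lift_comp_inl, Coprod.lift_comp_inr]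
    exacts [hα.left.comp H.subtype_injective, hα.right.comp Coprod.inr_injective, hinl]
  exact ⟨X, inferInstance, inferInstance, μ, inferInstance, α₁, α₃,
    ⟨hα.left, h₂₃.right, hα.orbitSetoid_eq.trans h₂₃.orbitSetoid_eq⟩, by simp [α₃]⟩

end OrbitEquivalence

theorem mainTheorem5
    (G : Type u) [Group G] [Countable G] (Γ₀ : Subgroup G)
    (Γ₁ : Type u) [Group Γ₁] [Countable Γ₁] (Γ₁₀ : Subgroup Γ₁) (e₁ : Γ₀ ≃* Γ₁₀) :
    (∀ (Γ₂ : Type u) [Group Γ₂] [Countable Γ₂] (Γ₂₀ : Subgroup Γ₂) (e₂ : Γ₀ ≃* Γ₂₀),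
      StrongPairOEVia Γ₁₀ Γ₂₀ (e₁.symm.trans e₂) →
      StrongPairOE
        (AmalgProd.inl Γ₀.subtype (Γ₁₀.subtype.comp e₁.toMonoidHom)).range
        (AmalgProd.inl Γ₀.subtype (Γ₂₀.subtype.comp e₂.toMonoidHom)).range) ∧
    (∀ (Γ₂' : Type u) [Group Γ₂'] [Countable Γ₂'],
      PairOE Γ₁₀ (Monoid.Coprod.inl : Γ₁₀ →* Monoid.Coprod Γ₁₀ Γ₂').range →
      StrongPairOE
        (AmalgProd.inl Γ₀.subtype (Γ₁₀.subtype.comp e₁.toMonoidHom)).range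
        (Monoid.Coprod.inl : G →* Monoid.Coprod G Γ₂').range) := by
  have hΓ₀ := Γ₀.subtype_injective
  have hk₁ : Function.Injective (Γ₁₀.subtype.comp e₁.toMonoidHom) :=
    Γ₁₀.subtype_injective.comp e₁.injective
  refine ⟨fun Γ₂ _ _ Γ₂₀ e₂ h => ?_, fun L _ _ h => ?_⟩
  · have hk₂ : Function.Injective (Γ₂₀.subtype.comp e₂.toMonoidHom) :=
      Γ₂₀.subtype_injective.comp e₂.injective
    have hover : StrictOEOver (Γ₁₀.subtype.comp e₁.toMonoidHom)
        (Γ₂₀.subtype.comp e₂.toMonoidHom) := by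
      convert h.strictOEOver.comp e₁.toMonoidHom using 1
      ext
      simp
    exact (hover.amalgProd hΓ₀ hk₁ hk₂).strongPairOE_range (AmalgProd.inl_injective hΓ₀ hk₁)
      (AmalgProd.inl_injective hΓ₀ hk₂)
  · have hamalg := (h.strictOEOver_subtype_inl.comp e₁.toMonoidHom).amalgProd hΓ₀ hk₁
      (Monoid.Coprod.inl_injective.comp e₁.injective)
    have hover := hamalg.of_mulEquiv_apply (AmalgProd.coprodMulEquiv_inl Γ₀.subtype e₁ fun _ => rfl)
    exact hover.strongPairOE_range (AmalgProd.inl_injective hΓ₀ hk₁) Monoid.Coprod.inl_injective
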